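/- Let $\mathcal X,\mathcal Y$ be arbitrary sets, $\ell\colon\mathcal Y\times\mathcal Y\to[0,1]$ a loss function, $\mathcal H$ any class of functions $h\colon\mathcal X\to\mathcal Y$, and for $h\in\mathcal H$ put $\ell_h(x,y)=\ell(h(x),y)$ and $L_{\mathcal H}=\{\ell_h: h\in\mathcal H\}$. For a function $f$ and a finite set $S$ let $\bar f(S)$ denote the average of $f$ over $S$. Fix a set $\mathcal Z_N\subseteq\mathcal X\times\mathcal Y$ of cardinality $N=m+u$ with $m=u$, and let $n\in\{1,\dots,m-1\}$. Let $\mathcal Z_m$ be a subset of $m$ elements sampled uniformly without replacement from $\mathcal Z_N$, let $\mathcal Z_u=\mathcal Z_N\setminus\mathcal Z_m$, and put $\mathrm{err}_m(h)=\overline{\ell_h}(\mathcal Z_m)$ and $\mathrm{err}_u(h)=\overline{\ell_h}(\mathcal Z_u)$. For a class $F$ of real functions on $\mathcal X\times\mathcal Y$ define the permutational Rademacher complexity $$\hat Q_{m,n}(F,\mathcal Z_m)=\mathop{\mathbb E}_{\mathcal Z_n}\ \sup_{f\in F}\bigl(\bar f(\mathcal Z_m\setminus\mathcal Z_n)-\bar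 f(\mathcal Z_n)\bigr),$$ where $\mathcal Z_n$ consists of $n$ elements sampled uniformly without replacement from $\mathcal Z_m$. Then for every $\delta\in(0,1)$, with probability at least $1-\delta$ over the random training set $\mathcal Z_m$, all $h\in\mathcal H$ simultaneously satisfy $$\mathrm{err}_u(h)\le \mathrm{err}_m(h)+\mathop{\mathbb E}_{\mathcal Z_m}\bigl[\hat Q_{m,n}(L_{\mathcal H},\mathcal Z_m)\bigr]+\sqrt{\frac{2N\log(1/\delta)}{(N-1/2)^2}}.$$ Moreover, with probability at least $1-\delta$, all $h\in\mathcal H$ simultaneously satisfy $$\mathrm{err}_u(h)\le \mathrm{err}_m(h)+\hat Q_{m,n}(L_{\mathcal H},\mathcal Z_m)+2\sqrt{\frac{2N\log(2/\delta)}{(N-1/2)^2}}.$$ -/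

import Mathlib

open scoped BigOperators

noncomputable section

namespace TransductivePRC

/-- The average `f̄(S)` of a real function `f` over a finite set `S`. -/
def avg {Z : Type*} (f : Z → ℝ) (S : Finset Z) : ℝ :=
  𝔼 z ∈ S, f z

/-- Expectation of `g(Z_m)`, where `Z_m` is an `m`-element subset of `A` sampled uniformly
without replacement from `A`: the average of `g` over all `m`-element subsets of `A`. -/
def expSubset {Z : Type*} (A : Finset Z) (m : ℕ) (g : Finset Z → ℝ) : ℝ :=
  𝔼 S ∈ A.powersetCard m, g S

open Classical in
/-- Probability of the event `P(Z_m)`, where `Z_m` is an `m`-element subset of `A` sampled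
uniformly without replacement from `A`: the proportion of `m`-element subsets satisfying `P`. -/
def probSubset {Z : Type*} (A : Finset Z) (m : ℕ) (P : Finset Z → Prop) : ℝ :=
  (((A.powersetCard m).filter P).card : ℝ) / ((A.powersetCard m).card : ℝ)

/-- Permutational Rademacher complexity `Q̂_{m,n}(F, Z_m)`, with `m` the cardinality of `Zm`:
the expectation, over a uniformly random `n`-element subset `Zn` of `Zm`, of the supremum
over `f ∈ F` of `f̄(Zm \ Zn) - f̄(Zn)`. -/
def prc {Z : Type*} [DecidableEq Z] (F : Set (Z → ℝ)) (n : ℕ) (Zm : Finset Z) : ℝ :=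
  expSubset Zm n fun Zn => ⨆ f : F, (avg (f : Z → ℝ) (Zm \ Zn) - avg (f : Z → ℝ) Zn)

/-- The function `ℓ_h(x, y) = ℓ(h(x), y)`. -/
def lossFun {X Y : Type*} (loss : Y → Y → ℝ) (h : X → Y) : X × Y → ℝ :=
  fun z => loss (h z.1) z.2

/-- The loss class `L_H = {ℓ_h : h ∈ H}`. -/
def lossClass {X Y : Type*} (loss : Y → Y → ℝ) (H : Set (X → Y)) : Set (X × Y → ℝ) :=
  {f | ∃ h ∈ H, f = lossFun loss h}

/-- The risk of `h` on a finite set `S` of input-output pairs: the average of `ℓ_h` over `S`. -/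
def risk {X Y : Type*} (loss : Y → Y → ℝ) (h : X → Y) (S : Finset (X × Y)) : ℝ :=
  avg (lossFun loss h) S

end TransductivePRC

end

noncomputable section

open Real Finset

namespace TransductivePRC

/-! The worst gap `supGap` between test and training averages concentrates around its mean, and
symmetrization bounds that mean by the expected complexity. The complexity concentrates too, so a
union bound gives the empirical version.

Concentration comes from the Doob martingale that reveals the sample one element at a time. Swapping
one element moves either functional by at most `2 / u`; with `k` draws left after the current one,
the conditional mean then oscillates by at most `2 / (u + k)`. Write `N = 2u`, `D = (N - 1/2)² / N`
and `S₂ = ∑ 1 / (u + k)²` over `k < u`. Hoeffding plus Markov would give the tail `exp (-ε² / (2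
S₂))`, but the target is `exp (-ε² D / 2)`, and `D S₂` exceeds `1` by about `1 / (4u)`.

Two refinements absorb this excess. Hoeffding's lemma gains a quartic term (`expect_exp_le`),
decisive for large deviations. Markov's inequality is sharpened by the centring of the variable
(`card_filter_le_of_expect_exp_le`), decisive for small ones. `exp_sum_hoeffdingExponent_le` checks
that together they suffice for every `u ≥ 2`. Deviations above `1` are trivial, as the averages lie
in `[0, 1]` and the complexity is nonnegative. -/

/-! ### Hoeffding's lemma with a quartic gain. -/

lemma nonneg_of_hasDerivAt_nonneg {f f' : ℝ → ℝ} (hf : ∀ x, HasDerivAt f (f' x) x)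
    (h0 : 0 ≤ f 0) (hf' : ∀ x, 0 ≤ x → 0 ≤ f' x) {x : ℝ} (hx : 0 ≤ x) : 0 ≤ f x := by
  have hmono : MonotoneOn f (Set.Ici 0) := by
    refine monotoneOn_of_deriv_nonneg (convex_Ici 0)
      (fun y _ => (hf y).continuousAt.continuousWithinAt)
      (fun y _ => (hf y).differentiableAt.differentiableWithinAt) fun y hy => ?_
    rw [interior_Ici] at hy
    rw [(hf y).deriv]
    exact hf' y (le_of_lt hy)
  exact h0.trans (hmono Set.self_mem_Ici hx hx)

/-- This and the next two inequalities are successive truncations of the continued fraction `s coth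
s = 1 + s² / (3 + s² / (5 + ⋯))`. In the last two, the derivative of the difference of the sides is
`s` times the preceding difference. -/
lemma sinh_le_mul_cosh {s : ℝ} (hs : 0 ≤ s) : sinh s ≤ s * cosh s := by
  have := nonneg_of_hasDerivAt_nonneg (f := fun s => s * cosh s - sinh s)
    (f' := fun s => s * sinh s) (fun x => by
      exact (((hasDerivAt_id x).mul (hasDerivAt_cosh x)).sub (hasDerivAt_sinh x)).congr_deriv
        (by simp)) (by simp) (fun x hx => mul_nonneg hx (sinh_nonneg_iff.2 hx)) hs
  simpa using this

lemma three_mul_cosh_le {s : ℝ} (hs : 0 ≤ s) : 3 * s * cosh s ≤ (3 + s ^ 2) * sinh s := by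
  have := nonneg_of_hasDerivAt_nonneg (f := fun s => (3 + s ^ 2) * sinh s - 3 * s * cosh s)
    (f' := fun s => s * (s * cosh s - sinh s)) (fun x => by
      exact (((((hasDerivAt_id x).pow 2).const_add 3).mul (hasDerivAt_sinh x)).sub
        (((hasDerivAt_id x).const_mul 3).mul (hasDerivAt_cosh x))).congr_deriv (by simp; ring)) (by simp)
    (fun x hx => mul_nonneg hx (sub_nonneg.2 (sinh_le_mul_cosh hx))) hs
  simpa using this

lemma five_mul_sinh_le {s : ℝ} (hs : 0 ≤ s) :
    5 * s ^ 2 * sinh s ≤ (15 + s ^ 2) * (s * cosh s - sinh s) := by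
  have := nonneg_of_hasDerivAt_nonneg
    (f := fun s => (15 + s ^ 2) * (s * cosh s - sinh s) - 5 * s ^ 2 * sinh s)
    (f' := fun s => s * ((3 + s ^ 2) * sinh s - 3 * s * cosh s)) (fun x => by
      exact (((((hasDerivAt_id x).pow 2).const_add 15).mul
        (((hasDerivAt_id x).mul (hasDerivAt_cosh x)).sub (hasDerivAt_sinh x))).sub
        ((((hasDerivAt_id x).pow 2).const_mul 5).mul (hasDerivAt_sinh x))).congr_deriv
        (by simp; ring)) (by simp)
    (fun x hx => mul_nonneg hx (sub_nonneg.2 (three_mul_cosh_le hx))) hs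
  simpa using this

/-- The exponent `s²/2 - κ s⁴` of the refined Hoeffding lemma. -/
def hoeffdingExponent (s : ℝ) : ℝ := s ^ 2 / 2 - 173 / 10000 * s ^ 4

/-- The left side is the log-moment of a centred two-point variable, maximized over its bias. The
difference of the sides has derivative `(x coth x - 1)² / x - 4κx³` with `κ = 173 / 10000`, and
tends to `0` at the origin. -/
lemma mul_coth_add_log_le {s : ℝ} (hs : 0 < s) (hs2 : s ≤ 2) :
    s * cosh s / sinh s - 1 + log (sinh s / s) ≤ hoeffdingExponent s := by
  let k : ℝ → ℝ := fun s => hoeffdingExponent s - (s * cosh s / sinh s - 1 + log (sinh s / s))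
  have hder : ∀ x, 0 < x → HasDerivAt k
      ((x * cosh x / sinh x - 1) ^ 2 / x - 4 * (173 / 10000) * x ^ 3) x := by
    intro x hx
    have hsx : 0 < sinh x := sinh_pos_iff.2 hx
    have h1 : HasDerivAt hoeffdingExponent (x - 4 * (173 / 10000) * x ^ 3) x := by
      exact ((((hasDerivAt_id x).pow 2).div_const 2).sub
        (((hasDerivAt_id x).pow 4).const_mul (173 / 10000))).congr_deriv (by simp; ring)
    have h2 := ((hasDerivAt_id x).mul (hasDerivAt_cosh x)).div (hasDerivAt_sinh x) hsx.ne'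
    have h3 := ((hasDerivAt_sinh x).div (hasDerivAt_id x) hx.ne').log
      (div_pos hsx hx).ne'
    refine (h1.sub ((h2.sub_const 1).add h3)).congr_deriv ?_
    simp
    field_simp
    ring
  have hmono : MonotoneOn k (Set.Ioc 0 2) := by
    refine monotoneOn_of_deriv_nonneg (convex_Ioc 0 2)
      (fun y hy => (hder y hy.1).continuousAt.continuousWithinAt)
      (fun y hy => ?_) fun y hy => ?_
    · rw [interior_Ioc] at hy
      exact (hder y hy.1).differentiableAt.differentiableWithinAt
    · rw [interior_Ioc] at hy
      obtain ⟨hy0, hy2⟩ := hy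
      rw [(hder y hy0).deriv, sub_nonneg, le_div_iff₀ hy0]
      have hsy : 0 < sinh y := sinh_pos_iff.2 hy0
      have h5 : 5 * y ^ 2 / (15 + y ^ 2) ≤ y * cosh y / sinh y - 1 := by
        rw [div_sub_one hsy.ne', div_le_div_iff₀ (by positivity) hsy]
        linarith [five_mul_sinh_le hy0.le]
      -- Here `y ≤ 2` enters; `κ` is chosen just below `(5 / 19)² / 4`.
      have h6 : 5 * y ^ 2 / 19 ≤ 5 * y ^ 2 / (15 + y ^ 2) := by
        apply div_le_div_of_nonneg_left (by positivity) (by positivity)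
        nlinarith
      have h7 := pow_le_pow_left₀ (by positivity) (h6.trans h5) 2
      have : 0 ≤ y ^ 4 := by positivity
      nlinarith
  -- The formula for `k` degenerates at `0`, so a crude lower bound on `k t` is passed to the limit
  -- `t → 0+`.
  have hlow : ∀ t, 0 < t → t ≤ s → -t ^ 2 ≤ k s + t ^ 4 := by
    intro t ht hts
    have hst : 0 < sinh t := sinh_pos_iff.2 ht
    refine le_trans ?_ (add_le_add_left (hmono ⟨ht, hts.trans hs2⟩ ⟨hs, hs2⟩ hts) _)
    have h1 : t * cosh t / sinh t - 1 ≤ t ^ 2 / 3 := by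
      rw [div_sub_one hst.ne', div_le_div_iff₀ hst (by positivity)]
      linarith [three_mul_cosh_le ht.le]
    have h2 : log (sinh t / t) ≤ t ^ 2 / 2 := by
      rw [log_le_iff_le_exp (div_pos hst ht)]
      refine le_trans ?_ (cosh_le_exp_half_sq t)
      rw [div_le_iff₀ ht]
      linarith [sinh_le_mul_cosh ht.le]
    simp only [k, hoeffdingExponent]
    nlinarith [pow_pos ht 4, pow_pos ht 2]
  have : 0 ≤ k s := by
    have hlim : Filter.Tendsto (fun t : ℝ => -t ^ 2 - t ^ 4) (nhdsWithin 0 (Set.Ioi 0))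
        (nhds 0) := by
      have : Continuous fun t : ℝ => -t ^ 2 - t ^ 4 := by fun_prop
      simpa using (this.tendsto 0).mono_left nhdsWithin_le_nhds
    refine le_of_tendsto hlim ?_
    filter_upwards [Ioc_mem_nhdsGT hs] with t ht
    linarith [hlow t ht.1 ht.2]
  simpa [k] using this

/-- A refinement of Hoeffding's lemma for a centred function on a finite set with
oscillation at most `c`. -/
lemma expect_exp_le {ι : Type*} {I : Finset ι} (hI : I.Nonempty) {X : ι → ℝ} {c l : ℝ}
    (hc : 0 < c) (hl : 0 < l) (hcl : l * c / 2 ≤ 2) (hX : 𝔼 i ∈ I, X i = 0)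
    (hosc : ∀ i ∈ I, ∀ j ∈ I, X i - X j ≤ c) :
    𝔼 i ∈ I, exp (l * X i) ≤ exp (hoeffdingExponent (l * c / 2)) := by
  obtain ⟨i₀, hi₀, hmin⟩ := I.exists_min_image X hI
  set a := X i₀ with ha
  set s := l * c / 2 with hs
  have hs0 : 0 < s := by positivity
  have hss : 0 < sinh s := sinh_pos_iff.2 hs0
  set τ := exp s * (sinh s / s) with hτ
  have hτ0 : 0 < τ := by positivity
  set p := -a / c with hp
  have h2s : exp (l * c) = 1 + 2 * s * τ := by
    rw [hτ, sinh_eq, show l * c = s + s by rw [hs]; ring, exp_add, exp_neg]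
    field_simp
    ring
  -- Chord bound for the exponential on `[l a, l a + l c]`, which reduces to the two-point variable
  -- of bias `p`.
  have hpt : ∀ i ∈ I, exp (l * X i) ≤ exp (l * a) * (1 + (X i - a) / c * (2 * s * τ)) := by
    intro i hi
    have h0 : 0 ≤ (X i - a) / c := div_nonneg (sub_nonneg.2 (hmin i hi)) hc.le
    have h1 : (X i - a) / c ≤ 1 := (div_le_one hc).2 (hosc i hi i₀ hi₀)
    have := convexOn_exp.2 (Set.mem_univ 0) (Set.mem_univ (l * c)) (sub_nonneg.2 h1) h0 (by ring)
    simp only [smul_eq_mul, mul_zero, zero_add, exp_zero, mul_one, h2s] at this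
    have e : l * X i = l * a + (X i - a) / c * (l * c) := by field_simp; ring
    rw [e, exp_add]
    refine mul_le_mul_of_nonneg_left (this.trans_eq (by ring)) (exp_pos _).le
  have hE : 𝔼 i ∈ I, exp (l * X i) ≤ exp (l * a) * (1 + p * (2 * s * τ)) := by
    refine (expect_le_expect hpt).trans_eq ?_
    rw [← mul_expect, expect_add_distrib, expect_const hI, ← expect_mul, ← expect_div,
      expect_sub_distrib, hX, expect_const hI, zero_sub]
  -- The choice of `τ` makes the factor `exp (l * a)` cancel the dependence on `p`, so no
  -- optimization over `p` is needed.
  have hv : (1 + p * (2 * s * τ)) / τ ≤ exp ((1 + p * (2 * s * τ)) / τ - 1) := by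
    linarith [add_one_le_exp ((1 + p * (2 * s * τ)) / τ - 1)]
  have hinv : 1 / τ = s * cosh s / sinh s - s := by
    rw [hτ, ← cosh_add_sinh s]
    have h1 : cosh s + sinh s ≠ 0 := by rw [cosh_add_sinh]; positivity
    field_simp
    nlinarith [cosh_sq s]
  calc 𝔼 i ∈ I, exp (l * X i) ≤ exp (l * a) * (1 + p * (2 * s * τ)) := hE
    _ ≤ exp (l * a) * (τ * exp ((1 + p * (2 * s * τ)) / τ - 1)) := by
        refine mul_le_mul_of_nonneg_left ?_ (exp_pos _).le
        rw [div_le_iff₀ hτ0] at hv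
        linarith
    _ = exp (s * cosh s / sinh s - 1 + log (sinh s / s)) := by
        rw [exp_add _ (log _), exp_log (by positivity), hτ]
        have e1 : (1 + p * (2 * s * τ)) / τ = s * cosh s / sinh s - s - l * a := by
          rw [add_div, hinv, hp, hs]; field_simp; ring
        rw [← hτ, e1, hτ, show s * cosh s / sinh s - s - l * a - 1
          = (s * cosh s / sinh s - 1) + -s + - (l * a) by ring, exp_add, exp_add, exp_neg, exp_neg]
        field_simp
    _ ≤ _ := exp_le_exp.2 (mul_coth_add_log_le hs0 hcl)

/-! ### Markov's inequality sharpened for centred variables. -/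

/-- The quadratic is the Taylor polynomial of `2y / (exp y - 1)`. Differentiating three times leaves
a positive function. -/
lemma le_exp_sub_one_mul {y : ℝ} (hy : 0 ≤ y) :
    2 * y ≤ (exp y - 1) * (2 - y + y ^ 2 / 6) := by
  have d (x : ℝ) (a b c : ℝ) : HasDerivAt (fun y : ℝ => a + b * y + c * y ^ 2)
      (b + 2 * c * x) x :=
    ((((hasDerivAt_id x).const_mul b).const_add a).add
      (((hasDerivAt_id x).pow 2).const_mul c)).congr_deriv (by simp; ring)
  have h3 : ∀ y : ℝ, 0 ≤ y → 0 ≤ exp y * (1 / 3 + -1 / 3 * y + 1 / 6 * y ^ 2) - 1 / 3 :=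
    fun y hy => nonneg_of_hasDerivAt_nonneg
      (f := fun y => exp y * (1 / 3 + -1 / 3 * y + 1 / 6 * y ^ 2) - 1 / 3)
      (f' := fun y => exp y * (y ^ 2 / 6))
      (fun x => (((hasDerivAt_exp x).mul (d x _ _ _)).sub_const _).congr_deriv (by ring))
      (by simp) (fun x hx => by positivity) hy
  have h2 : ∀ y : ℝ, 0 ≤ y → 0 ≤ exp y * (1 + -2 / 3 * y + 1 / 6 * y ^ 2)
      - (1 + 1 / 3 * y + 0 * y ^ 2) :=
    fun y hy => nonneg_of_hasDerivAt_nonneg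
      (f := fun y => exp y * (1 + -2 / 3 * y + 1 / 6 * y ^ 2) - (1 + 1 / 3 * y + 0 * y ^ 2))
      (f' := fun y => exp y * (1 / 3 + -1 / 3 * y + 1 / 6 * y ^ 2) - 1 / 3)
      (fun x => (((hasDerivAt_exp x).mul (d x _ _ _)).sub (d x _ _ _)).congr_deriv (by ring))
      (by simp) h3 hy
  have h1 := nonneg_of_hasDerivAt_nonneg
      (f := fun y => exp y * (2 + -1 * y + 1 / 6 * y ^ 2) - (2 + 1 * y + 1 / 6 * y ^ 2))
      (f' := fun y => exp y * (1 + -2 / 3 * y + 1 / 6 * y ^ 2) - (1 + 1 / 3 * y + 0 * y ^ 2))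
      (fun x => (((hasDerivAt_exp x).mul (d x _ _ _)).sub (d x _ _ _)).congr_deriv (by ring))
      (by simp) h2 hy
  linarith

/-- If the exponential moment of a centred function is small, then the proportion of points
with `ε ≤ X` is at most `exp (-y)`, where `l * ε = 2 * y`. -/
lemma card_filter_le_of_expect_exp_le {ι : Type*} {I : Finset ι} (hI : I.Nonempty)
    {X : ι → ℝ} {l ε y : ℝ} (hl : 0 < l) (hy : 0 < y) (hly : l * ε = 2 * y)
    (hX : 𝔼 i ∈ I, X i = 0) (P : ι → Prop) [DecidablePred P]
    (hP : ∀ i ∈ I, P i → ε ≤ X i)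
    (hexp : 𝔼 i ∈ I, exp (l * X i)
      ≤ exp y * (1 + exp (-2) * (1 - exp (-y)) * exp (-(y ^ 2 / 6)))) :
    ((I.filter P).card : ℝ) / I.card ≤ exp (-y) := by
  set w := 2 - y + y ^ 2 / 6 with hw
  set p := ((I.filter P).card : ℝ) / I.card with hp
  have hw0 : 0 ≤ w := by nlinarith [sq_nonneg (y - 3)]
  -- `B` is the gap at `2 * y` between `exp` and its tangent at `-w`. Off `P` the exponential is
  -- bounded below by this tangent, on `P` by the tangent plus `B`; the linear part averages to
  -- zero.
  set B := exp (2 * y) - exp (-w) * (1 + 2 * y + w) with hB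
  have hB0 : 0 < B := by
    have h1 : 2 * y + w + 1 < exp (2 * y + w) := add_one_lt_exp (by positivity)
    have h2 : exp (-w) * exp (2 * y + w) = exp (2 * y) := by rw [← exp_add]; ring_nf
    have := mul_lt_mul_of_pos_left h1 (exp_pos (-w))
    rw [hB]; linarith
  have hpt : ∀ i ∈ I, exp (-w) * (1 + w) + exp (-w) * l * X i + (if P i then B else 0)
      ≤ exp (l * X i) := by
    intro i hi
    have htan : ∀ c v : ℝ, exp c * (1 + v - c) ≤ exp v := fun c v => by
      have := mul_le_mul_of_nonneg_left (add_one_le_exp (v - c)) (exp_pos c).le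
      rw [← exp_add, add_sub_cancel] at this
      linarith
    split_ifs with h
    · have h1 := htan (2 * y) (l * X i)
      have h2 : 2 * y ≤ l * X i := hly ▸ mul_le_mul_of_nonneg_left (hP i hi h) hl.le
      have h3 : exp (-w) ≤ exp (2 * y) := exp_le_exp.2 (by linarith)
      rw [hB]
      nlinarith [mul_nonneg (sub_nonneg.2 h2) (sub_nonneg.2 h3)]
    · have := htan (-w) (l * X i)
      linarith
  have hlow : exp (-w) * (1 + w) + p * B ≤ 𝔼 i ∈ I, exp (l * X i) := by
    refine le_of_eq_of_le ?_ (expect_le_expect hpt)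
    rw [expect_add_distrib, expect_add_distrib, expect_const hI, ← mul_expect, hX, mul_zero,
      add_zero, expect_eq_sum_div_card, ← sum_filter, sum_const, nsmul_eq_mul, hp]
    ring
  have hE : exp y * exp (-y) = 1 := by rw [← exp_add]; simp
  have hE2 : exp (2 * y) = exp y * exp y := by rw [← exp_add]; ring_nf
  have hew : exp (-w) = exp (-2) * exp y * exp (-(y ^ 2 / 6)) := by
    rw [← exp_add, ← exp_add, hw]; ring_nf
  have hkey := le_exp_sub_one_mul hy.le
  have hkey' : 2 * y * exp (-y) ≤ (1 - exp (-y)) * w := by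
    have := mul_le_mul_of_nonneg_right hkey (exp_pos (-y)).le
    rw [hw]; linear_combination this + (2 - y + y ^ 2 / 6) * hE
  by_contra! hlt
  have h1 : exp (-w) * (1 + w) + exp (-y) * B < 𝔼 i ∈ I, exp (l * X i) :=
    lt_of_lt_of_le (by nlinarith) hlow
  have h2 : exp y + exp (-w) * (1 - exp (-y)) ≤ exp (-w) * (1 + w) + exp (-y) * B := by
    have h3 : exp (-y) * exp (2 * y) = exp y := by rw [hE2]; linear_combination exp y * hE
    have h4 := mul_le_mul_of_nonneg_left hkey' (exp_pos (-w)).le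
    rw [hB]
    linear_combination h4 - h3
  have h5 : exp y * (1 + exp (-2) * (1 - exp (-y)) * exp (-(y ^ 2 / 6)))
      = exp y + exp (-w) * (1 - exp (-y)) := by rw [hew]; ring
  linarith

/-! ### Numerical bounds on the excess exponent. -/

/-- Each exponential on the right is replaced by a polynomial bound, and `exp q ≤ 1 / (1 - q)`. The
constant `127 / 1000` lies below `1353 / 10000 * (1 - 59 / 1000)`, where `1353 / 10000 ≤ exp (-2)`.
-/
lemma exp_le_one_add_of_le {q y : ℝ} (hy : 0 ≤ y) (hy4 : y ≤ 4) (hq : q ≤ 59 / 1000)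
    (h : q * (1 + (y + y ^ 2 / 2 + y ^ 3 / 6))
      ≤ 127 / 1000 * (y + y ^ 2 / 2 + y ^ 3 / 6) * (1 - y ^ 2 / 24) ^ 4) :
    exp q ≤ 1 + exp (-2) * (1 - exp (-y)) * exp (-(y ^ 2 / 6)) := by
  set A := y + y ^ 2 / 2 + y ^ 3 / 6 with hA
  have hA0 : 0 ≤ A := by positivity
  have h2 : (1353 / 10000 : ℝ) ≤ exp (-2) := by
    have h1 := exp_one_lt_d9
    have : exp (-2) * (exp 1 * exp 1) = 1 := by rw [← exp_add, ← exp_add]; norm_num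
    have h3 : exp 1 * exp 1 ≤ 2.7182818286 * 2.7182818286 :=
      mul_le_mul h1.le h1.le (exp_pos _).le (by norm_num)
    nlinarith [exp_pos (-2)]
  have h3 : A / (1 + A) ≤ 1 - exp (-y) := by
    have h4 : 1 + A ≤ exp y := by
      have := sum_le_exp_of_nonneg hy 4
      simp [Finset.sum_range_succ, Nat.factorial] at this
      linarith
    rw [exp_neg, div_le_iff₀ (by positivity)]
    have : (exp y)⁻¹ * (1 + A) ≤ 1 := by
      rw [inv_mul_le_iff₀ (exp_pos y)]; linarith
    linarith
  have h4 : (1 - y ^ 2 / 24) ^ 4 ≤ exp (-(y ^ 2 / 6)) := by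
    have := one_sub_div_pow_le_exp_neg (n := 4) (t := y ^ 2 / 6) (by norm_num; nlinarith)
    refine le_trans (le_of_eq ?_) this
    norm_num; ring
  set g := exp (-2) * (1 - exp (-y)) * exp (-(y ^ 2 / 6)) with hg
  have h5 : 1353 / 10000 * (A / (1 + A)) * (1 - y ^ 2 / 24) ^ 4 ≤ g := by
    have : 0 ≤ A / (1 + A) := by positivity
    have h6 : 0 ≤ (1 - y ^ 2 / 24) ^ 4 := by positivity
    have h7 : 0 ≤ exp (-2) * (1 - exp (-y)) := mul_nonneg (exp_pos _).le (this.trans h3)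
    rw [hg]
    gcongr
  have h6 : q ≤ 127 / 1000 * (A / (1 + A)) * (1 - y ^ 2 / 24) ^ 4 := by
    rw [show 127 / 1000 * (A / (1 + A)) * (1 - y ^ 2 / 24) ^ 4
      = 127 / 1000 * A * (1 - y ^ 2 / 24) ^ 4 / (1 + A) by ring, le_div_iff₀ (by positivity)]
    exact h
  set T := (A / (1 + A)) * (1 - y ^ 2 / 24) ^ 4 with hT
  have hT0 : 0 ≤ T := by positivity
  have h7 : q ≤ g * (1 - q) := by nlinarith
  have h8 : exp q * (1 - q) ≤ 1 := by
    have h9 : exp q * exp (-q) = 1 := by rw [← exp_add]; simp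
    nlinarith [add_one_le_exp (-q), exp_pos q]
  nlinarith

lemma quadratic_mul_le_left {y : ℝ} (hy : 0 ≤ y) (hy2 : y ≤ 11 / 5) :
    (53 / 500 - 121 / 2500 * y) * (1 + (y + y ^ 2 / 2 + y ^ 3 / 6))
      ≤ 127 / 1000 * (1 + y / 2 + y ^ 2 / 6) * (1 - y ^ 2 / 24) ^ 4 := by
  have h1 := hy
  have h2 := sub_nonneg.2 hy2
  -- Both sides have degree at most `10`; the hints are the Bernstein basis of the interval.
  linarith [pow_nonneg h2 10,
      mul_nonneg (pow_nonneg h1 1) (pow_nonneg h2 9),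
      mul_nonneg (pow_nonneg h1 2) (pow_nonneg h2 8),
      mul_nonneg (pow_nonneg h1 3) (pow_nonneg h2 7),
      mul_nonneg (pow_nonneg h1 4) (pow_nonneg h2 6),
      mul_nonneg (pow_nonneg h1 5) (pow_nonneg h2 5),
      mul_nonneg (pow_nonneg h1 6) (pow_nonneg h2 4),
      mul_nonneg (pow_nonneg h1 7) (pow_nonneg h2 3),
      mul_nonneg (pow_nonneg h1 8) (pow_nonneg h2 2),
      mul_nonneg (pow_nonneg h1 9) (pow_nonneg h2 1),
      pow_nonneg h1 10]

lemma quadratic_mul_le_right {y : ℝ} (hy : 0 ≤ y) (hy2 : y ≤ 311 / 100) :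
    (1 / 16 - 201 / 10000 * y) * (1 + (y + y ^ 2 / 2 + y ^ 3 / 6))
      ≤ 127 / 1000 * (1 + y / 2 + y ^ 2 / 6) * (1 - y ^ 2 / 24) ^ 4 := by
  rcases le_total y (311 / 200) with h | h
  · have h1 := hy
    have h2 := sub_nonneg.2 h
    linarith [pow_nonneg h2 10,
      mul_nonneg (pow_nonneg h1 1) (pow_nonneg h2 9),
      mul_nonneg (pow_nonneg h1 2) (pow_nonneg h2 8),
      mul_nonneg (pow_nonneg h1 3) (pow_nonneg h2 7),
      mul_nonneg (pow_nonneg h1 4) (pow_nonneg h2 6),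
      mul_nonneg (pow_nonneg h1 5) (pow_nonneg h2 5),
      mul_nonneg (pow_nonneg h1 6) (pow_nonneg h2 4),
      mul_nonneg (pow_nonneg h1 7) (pow_nonneg h2 3),
      mul_nonneg (pow_nonneg h1 8) (pow_nonneg h2 2),
      mul_nonneg (pow_nonneg h1 9) (pow_nonneg h2 1),
      pow_nonneg h1 10]
  · have h1 := sub_nonneg.2 h
    have h2 := sub_nonneg.2 hy2
    linarith [pow_nonneg h2 10,
      mul_nonneg (pow_nonneg h1 1) (pow_nonneg h2 9),
      mul_nonneg (pow_nonneg h1 2) (pow_nonneg h2 8),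
      mul_nonneg (pow_nonneg h1 3) (pow_nonneg h2 7),
      mul_nonneg (pow_nonneg h1 4) (pow_nonneg h2 6),
      mul_nonneg (pow_nonneg h1 5) (pow_nonneg h2 5),
      mul_nonneg (pow_nonneg h1 6) (pow_nonneg h2 4),
      mul_nonneg (pow_nonneg h1 7) (pow_nonneg h2 3),
      mul_nonneg (pow_nonneg h1 8) (pow_nonneg h2 2),
      mul_nonneg (pow_nonneg h1 9) (pow_nonneg h2 1),
      pow_nonneg h1 10]

/-- Where `n ≤ 0` nothing is needed; otherwise the quadratic is positive, which confines `y` to an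
interval where the polynomial inequalities hold. -/
lemma exp_quadratic_le {y n : ℝ} (hy : 0 < y)
    (hn : 0 < n → n ≤ 53 / 500 * y - 121 / 2500 * y ^ 2 ∨ n ≤ 1 / 16 * y - 201 / 10000 * y ^ 2) :
    exp n ≤ 1 + exp (-2) * (1 - exp (-y)) * exp (-(y ^ 2 / 6)) := by
  rcases le_or_gt n 0 with h0 | h0
  · have h1 : exp n ≤ 1 := exp_le_one_iff.2 h0
    have h2 : 0 ≤ 1 - exp (-y) := sub_nonneg.2 (exp_le_one_iff.2 (by linarith))
    have : 0 ≤ exp (-2) * (1 - exp (-y)) * exp (-(y ^ 2 / 6)) := by positivity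
    linarith
  rcases hn h0 with hn | hn
  · have hy2 : y ≤ 11 / 5 := by by_contra!; nlinarith
    refine (exp_le_exp.2 hn).trans (exp_le_one_add_of_le hy.le (by linarith)
      (by nlinarith [sq_nonneg (y - 11 / 10)]) ?_)
    linarith [mul_le_mul_of_nonneg_left (quadratic_mul_le_left hy.le hy2) hy.le]
  · have hy2 : y ≤ 311 / 100 := by by_contra!; nlinarith
    refine (exp_le_exp.2 hn).trans (exp_le_one_add_of_le hy.le (by linarith)
      (by nlinarith [sq_nonneg (y - 3 / 2)]) ?_)
    linarith [mul_le_mul_of_nonneg_left (quadratic_mul_le_right hy.le hy2) hy.le]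

/-- Telescoping of a truncated Euler–Maclaurin expansion; the omitted term has the favourable sign,
here and in the next lemma. -/
lemma sum_inv_sq_le {x : ℝ} (hx : 0 < x) (v : ℕ) :
    ∑ k ∈ range v, 1 / (x + k) ^ 2 ≤ (1 / x + 1 / (2 * x ^ 2) + 1 / (6 * x ^ 3))
      - (1 / (x + v) + 1 / (2 * (x + v) ^ 2) + 1 / (6 * (x + v) ^ 3)) := by
  induction v with
  | zero => simp
  | succ v ih =>
    rw [sum_range_succ, Nat.cast_succ, ← add_assoc]
    have hj : 0 < x + v := by positivity
    generalize x + v = j at *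
    have : 1 / j + 1 / (2 * j ^ 2) + 1 / (6 * j ^ 3)
        - (1 / (j + 1) + 1 / (2 * (j + 1) ^ 2) + 1 / (6 * (j + 1) ^ 3)) - 1 / j ^ 2
        = 1 / (6 * j ^ 3 * (j + 1) ^ 3) := by
      field_simp; ring
    have h2 : 0 < 1 / (6 * j ^ 3 * (j + 1) ^ 3) := by positivity
    linarith

lemma le_sum_inv_pow_four {x : ℝ} (hx : 0 < x) (v : ℕ) :
    (1 / (3 * x ^ 3) + 1 / (2 * x ^ 4)) - (1 / (3 * (x + v) ^ 3) + 1 / (2 * (x + v) ^ 4))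
      ≤ ∑ k ∈ range v, 1 / (x + k) ^ 4 := by
  induction v with
  | zero => simp
  | succ v ih =>
    rw [sum_range_succ, Nat.cast_succ, ← add_assoc]
    have hj : 0 < x + v := by positivity
    generalize x + v = j at *
    have : 1 / j ^ 4 - (1 / (3 * j ^ 3) + 1 / (2 * j ^ 4)
        - (1 / (3 * (j + 1) ^ 3) + 1 / (2 * (j + 1) ^ 4)))
        = (10 * j ^ 2 + 10 * j + 3) / (6 * j ^ 4 * (j + 1) ^ 4) := by
      field_simp; ring
    have h2 : 0 < (10 * j ^ 2 + 10 * j + 3) / (6 * j ^ 4 * (j + 1) ^ 4) := by positivity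
    linarith

lemma sum_inv_sq_le_of_four_le {x : ℝ} {u : ℕ} (hxu : x = u) (hu : 4 ≤ u) :
    ∑ k ∈ range u, 1 / (x + k) ^ 2 ≤ (2 * x + 1 / 2) / (2 * x - 1 / 2) ^ 2 := by
  have hx : 4 ≤ x := by rw [hxu]; exact_mod_cast hu
  have hx0 : 0 < x := by linarith
  refine (sum_inv_sq_le hx0 u).trans ?_
  rw [← hxu]
  have h : 1 / x + 1 / (2 * x ^ 2) + 1 / (6 * x ^ 3)
      - (1 / (x + x) + 1 / (2 * (x + x) ^ 2) + 1 / (6 * (x + x) ^ 3))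
      = (24 * x ^ 2 + 18 * x + 7) / (48 * x ^ 3) := by
    field_simp; ring
  rw [h, div_le_div_iff₀ (by positivity) (by apply pow_pos; linarith)]
  nlinarith [mul_nonneg (sub_nonneg.2 hx) hx0.le, pow_pos hx0 3]

lemma le_sum_inv_pow_four_of_four_le {x : ℝ} {u : ℕ} (hxu : x = u) (hu : 4 ≤ u) :
    149 / 32 * x ^ 2 ≤ (2 * x - 1 / 2) ^ 4 * x * ∑ k ∈ range u, 1 / (x + k) ^ 4 := by
  have hx : 4 ≤ x := by rw [hxu]; exact_mod_cast hu
  have hx0 : 0 < x := by linarith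
  have h1 := le_sum_inv_pow_four hx0 u
  rw [← hxu] at h1
  have h : 1 / (3 * x ^ 3) + 1 / (2 * x ^ 4)
      - (1 / (3 * (x + x) ^ 3) + 1 / (2 * (x + x) ^ 4)) = (28 * x + 45) / (96 * x ^ 4) := by
    field_simp; ring
  rw [h] at h1
  refine le_trans ?_ (mul_le_mul_of_nonneg_left h1 (by positivity))
  rw [mul_div_assoc', le_div_iff₀ (by positivity)]
  have key : 447 * x ^ 5 ≤ (2 * x - 1 / 2) ^ 4 * (28 * x + 45) := by
    obtain ⟨t, ht, rfl⟩ : ∃ t : ℝ, 0 ≤ t ∧ x = 4 + t := ⟨x - 4, by linarith, by ring⟩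
    have : 0 ≤ (2 * (4 + t) - 1 / 2) ^ 4 * (28 * (4 + t) + 45) - 447 * (4 + t) ^ 5 := by
      ring_nf
      positivity
    linarith
  nlinarith [mul_le_mul_of_nonneg_left key hx0.le]

lemma exp_sum_hoeffdingExponent_le {u : ℕ} (hu : 2 ≤ u) {y l : ℝ} (hy : 0 < y)
    (hl : l ^ 2 = 2 * y * ((2 * u - 1 / 2) ^ 2 / (2 * u))) :
    exp (∑ k ∈ range u, hoeffdingExponent (l / (u + k)))
      ≤ exp y * (1 + exp (-2) * (1 - exp (-y)) * exp (-(y ^ 2 / 6))) := by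
  set D : ℝ := (2 * u - 1 / 2) ^ 2 / (2 * u) with hD
  set S2 : ℝ := ∑ k ∈ range u, 1 / ((u : ℝ) + k) ^ 2 with hS2
  set S4 : ℝ := ∑ k ∈ range u, 1 / ((u : ℝ) + k) ^ 4 with hS4
  have hsum : ∑ k ∈ range u, hoeffdingExponent (l / (u + k))
      = y + (y * (D * S2 - 1) - 173 / 2500 * y ^ 2 * (D ^ 2 * S4)) := by
    have h1 : ∑ k ∈ range u, hoeffdingExponent (l / (u + k))
        = l ^ 2 / 2 * S2 - 173 / 10000 * (l ^ 2) ^ 2 * S4 := by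
      rw [hS2, hS4, mul_sum, mul_sum, ← sum_sub_distrib]
      refine sum_congr rfl fun k _ => ?_
      rw [hoeffdingExponent, div_pow, div_pow]
      ring
    rw [h1, hl]; ring
  rw [hsum, exp_add]
  refine mul_le_mul_of_nonneg_left (exp_quadratic_le hy fun hn0 => ?_) (exp_pos _).le
  have hy2 : 0 < y ^ 2 := by positivity
  rcases (show u = 2 ∨ u = 3 ∨ 4 ≤ u by omega) with rfl | rfl | h4
  · left
    have hD' : D = 49 / 16 := by rw [hD]; norm_num
    have hS2' : S2 = 13 / 36 := by rw [hS2]; norm_num [sum_range_succ]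
    have hS4' : S4 = 97 / 1296 := by rw [hS4]; norm_num [sum_range_succ]
    rw [hD', hS2', hS4']
    linarith
  · have hD' : D = 121 / 24 := by rw [hD]; norm_num
    have hS2' : S2 = 769 / 3600 := by rw [hS2]; norm_num [sum_range_succ]
    have hS4' : S4 = 231361 / 12960000 := by rw [hS4]; norm_num [sum_range_succ]
    rw [hD', hS2', hS4']
    -- The excess lies below a convex combination of the two quadratics, hence below one of them.
    by_contra! hcon
    linarith [hcon.1, hcon.2]
  · right
    have h2 := sum_inv_sq_le_of_four_le rfl h4
    have h3 := le_sum_inv_pow_four_of_four_le rfl h4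
    rw [← hS2] at h2
    rw [← hS4] at h3
    have hx : (4 : ℝ) ≤ u := by exact_mod_cast h4
    generalize (u : ℝ) = x at *
    have hx0 : 0 < x := by linarith
    have hD0 : 0 < 2 * x - 1 / 2 := by linarith
    have e1 : D * S2 - 1 ≤ 1 / (4 * x) := by
      have := mul_le_mul_of_nonneg_left h2 (show 0 ≤ D by rw [hD]; positivity)
      refine (sub_le_sub_right this 1).trans_eq ?_
      rw [hD, div_mul_div_comm, mul_comm (2 * x), mul_div_mul_left _ _ (pow_ne_zero 2 hD0.ne')]
      field_simp
      ring
    have e2 : 149 / 128 / x ≤ D ^ 2 * S4 := by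
      rw [hD, div_pow, div_mul_eq_mul_div, div_le_div_iff₀ hx0 (by positivity)]
      nlinarith
    -- Both terms scale like `1 / x`, so the quadratic suited to `x = 4` serves for all larger `x`.
    have e3 : y * (D * S2 - 1) - 173 / 2500 * y ^ 2 * (D ^ 2 * S4)
        ≤ 4 / x * (1 / 16 * y - 201 / 10000 * y ^ 2) := by
      have a1 := mul_le_mul_of_nonneg_left e1 hy.le
      have a2 := mul_le_mul_of_nonneg_left e2 hy2.le
      have a3 : 0 ≤ y ^ 2 / x := by positivity
      have a4 : y * (1 / (4 * x)) = 4 / x * (1 / 16 * y) := by field_simp; norm_num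
      have a5 : 4 / x * (201 / 10000 * y ^ 2) = 804 / 10000 * (y ^ 2 / x) := by ring
      have a6 : y ^ 2 * (149 / 128 / x) = 149 / 128 * (y ^ 2 / x) := by ring
      linarith
    have e4 : 4 / x ≤ 1 := (div_le_one hx0).2 hx
    have e5 : 0 < 4 / x := by positivity
    have e6 : 0 < 1 / 16 * y - 201 / 10000 * y ^ 2 := pos_of_mul_pos_right (hn0.trans_le e3) e5.le
    exact e3.trans (mul_le_of_le_one_left e6.le e4)

/-! ### Averaging over uniform random subsets. -/

section

variable {Z : Type*}

lemma expSubset_const {A : Finset Z} {m : ℕ} (h : m ≤ A.card) (c : ℝ) :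
    expSubset A m (fun _ => c) = c :=
  expect_const (powersetCard_nonempty.2 h) c

lemma expSubset_mono {A : Finset Z} {m : ℕ} {g g' : Finset Z → ℝ}
    (h : ∀ S ⊆ A, S.card = m → g S ≤ g' S) : expSubset A m g ≤ expSubset A m g' :=
  expect_le_expect fun S hS => h S (mem_powersetCard.1 hS).1 (mem_powersetCard.1 hS).2

lemma expSubset_congr {A : Finset Z} {m : ℕ} {g g' : Finset Z → ℝ}
    (h : ∀ S ⊆ A, S.card = m → g S = g' S) : expSubset A m g = expSubset A m g' :=
  expect_congr rfl fun S hS => h S (mem_powersetCard.1 hS).1 (mem_powersetCard.1 hS).2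

lemma expect_expect_eq_div {ι κ : Type*} (s : Finset ι) (t : ι → Finset κ) (f : ι → κ → ℝ)
    {c : ℕ} (hc : ∀ i ∈ s, (t i).card = c) :
    𝔼 i ∈ s, 𝔼 j ∈ t i, f i j = (∑ i ∈ s, ∑ j ∈ t i, f i j) / ((s.card * c : ℕ) : ℝ) := by
  have h : ∀ i ∈ s, 𝔼 j ∈ t i, f i j = (∑ j ∈ t i, f i j) / c := fun i hi => by
    rw [expect_eq_sum_div_card, hc i hi]
  rw [expect_congr rfl h, expect_eq_sum_div_card, ← sum_div, div_div, Nat.cast_mul, mul_comm]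

variable [DecidableEq Z]

/-- Choosing a random set and then a random element of it amounts to choosing the element
first. -/
lemma expSubset_expect (A : Finset Z) (m : ℕ) (g : Finset Z → Z → ℝ) :
    expSubset A (m + 1) (fun S => 𝔼 x ∈ S, g S x)
      = 𝔼 x ∈ A, expSubset (A.erase x) m (fun T => g (insert x T) x) := by
  unfold expSubset
  rw [expect_expect_eq_div (c := m + 1) _ _ _ fun S hS => (mem_powersetCard.1 hS).2,
    expect_expect_eq_div (c := (A.card - 1).choose m) _ _ _ fun x hx => by
      rw [card_powersetCard, card_erase_of_mem hx]]
  congr 1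
  · rw [sum_sigma', sum_sigma']
    refine sum_bij' (fun p _ => ⟨p.2, p.1.erase p.2⟩) (fun p _ => ⟨insert p.1 p.2, p.1⟩)
      ?_ ?_ ?_ ?_ ?_
    · rintro ⟨S, x⟩ h
      simp only [mem_sigma, mem_powersetCard] at h ⊢
      exact ⟨h.1.1 h.2, erase_subset_erase x h.1.1, by rw [card_erase_of_mem h.2, h.1.2]; rfl⟩
    · rintro ⟨x, T⟩ h
      simp only [mem_sigma, mem_powersetCard] at h ⊢
      have hx : x ∉ T := fun hx => by simpa using h.2.1 hx
      refine ⟨⟨insert_subset h.1 (h.2.1.trans (erase_subset _ _)), ?_⟩, mem_insert_self _ _⟩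
      rw [card_insert_of_notMem hx, h.2.2]
    · rintro ⟨S, x⟩ h
      simp only [mem_sigma] at h
      simp [insert_erase h.2]
    · rintro ⟨x, T⟩ h
      simp only [mem_sigma, mem_powersetCard] at h
      have hx : x ∉ T := fun hx => by simpa using h.2.1 hx
      simp [erase_insert hx]
    · rintro ⟨S, x⟩ h
      simp only [mem_sigma] at h
      simp [insert_erase h.2]
  · rw [card_powersetCard]
    rcases Nat.eq_zero_or_pos A.card with h | h
    · simp [h]
    · obtain ⟨k, hk⟩ : ∃ k, A.card = k + 1 := ⟨A.card - 1, by omega⟩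
      rw [hk, Nat.add_sub_cancel, Nat.add_one_mul_choose_eq]

lemma expSubset_succ (A : Finset Z) (m : ℕ) (g : Finset Z → ℝ) :
    expSubset A (m + 1) g = 𝔼 x ∈ A, expSubset (A.erase x) m (fun T => g (insert x T)) := by
  rw [← expSubset_expect A m fun S _ => g S]
  refine expSubset_congr fun S _ hS => ?_
  rw [expect_const (card_pos.1 (by omega))]

lemma expSubset_avg {A : Finset Z} {n : ℕ} (hn : 1 ≤ n) (hA : n ≤ A.card) (f : Z → ℝ) :
    expSubset A n (avg f) = avg f A := by
  obtain ⟨k, rfl⟩ : ∃ k, n = k + 1 := ⟨n - 1, by omega⟩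
  refine (expSubset_expect A k fun _ x => f x).trans (expect_congr rfl fun x hx => ?_)
  exact expSubset_const (by rw [card_erase_of_mem hx]; omega) _

/-- Choosing a random set and then a random subset of it amounts to choosing the subset
first. -/
lemma expSubset_expSubset_subset {A : Finset Z} {m n : ℕ} (hnm : n ≤ m)
    (g : Finset Z → Finset Z → ℝ) :
    expSubset A m (fun S => expSubset S n fun B => g (S \ B) B)
      = expSubset A n (fun B => expSubset (A \ B) (m - n) fun T => g T B) := by
  unfold expSubset
  rw [expect_expect_eq_div (c := m.choose n) _ _ _ fun S hS => by
      rw [card_powersetCard, (mem_powersetCard.1 hS).2],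
    expect_expect_eq_div (c := (A.card - n).choose (m - n)) _ _ _ fun B hB => by
      rw [mem_powersetCard] at hB
      rw [card_powersetCard, card_sdiff_of_subset hB.1, hB.2]]
  congr 1
  · rw [sum_sigma', sum_sigma']
    refine sum_bij' (fun p _ => ⟨p.2, p.1 \ p.2⟩) (fun p _ => ⟨p.1 ∪ p.2, p.1⟩) ?_ ?_ ?_ ?_ ?_
    · rintro ⟨S, B⟩ h
      simp only [mem_sigma, mem_powersetCard] at h ⊢
      exact ⟨⟨h.2.1.trans h.1.1, h.2.2⟩, sdiff_subset_sdiff h.1.1 le_rfl, by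
        rw [card_sdiff_of_subset h.2.1, h.1.2, h.2.2]⟩
    · rintro ⟨B, T⟩ h
      simp only [mem_sigma, mem_powersetCard, subset_sdiff] at h ⊢
      refine ⟨⟨union_subset h.1.1 h.2.1.1, ?_⟩, subset_union_left, h.1.2⟩
      rw [card_union_of_disjoint h.2.1.2.symm]; omega
    · rintro ⟨S, B⟩ h
      simp only [mem_sigma, mem_powersetCard] at h
      simp [union_sdiff_of_subset h.2.1]
    · rintro ⟨B, T⟩ h
      simp only [mem_sigma, mem_powersetCard, subset_sdiff] at h
      simp [union_sdiff_cancel_left h.2.1.2.symm]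
    · rintro ⟨S, B⟩ h
      rfl
  · rw [card_powersetCard, card_powersetCard]
    rw [Nat.choose_mul hnm]

/-- Either order of drawing amounts to drawing the union, of size `k + j`, and splitting it at
random; complementation in the union matches the two splittings. -/
lemma expSubset_expSubset_sdiff_comm (A : Finset Z) (k j : ℕ) (g : Finset Z → Finset Z → ℝ) :
    expSubset A k (fun T => expSubset (A \ T) j fun B => g T B)
      = expSubset A j (fun B => expSubset (A \ B) k fun T => g T B) := by
  rw [← Nat.add_sub_cancel k j, ← expSubset_expSubset_subset (Nat.le_add_left j k)]
  rw [Nat.add_sub_cancel]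
  have := expSubset_expSubset_subset (A := A) (Nat.le_add_right k j) fun B T => g T B
  rw [Nat.add_sub_cancel_left] at this
  rw [← this]
  refine expSubset_congr fun S _ hS => ?_
  unfold expSubset
  refine expect_bij' (fun T _ => S \ T) (fun B _ => S \ B) ?_ ?_ ?_ ?_ ?_
  · intro T hT
    rw [mem_powersetCard] at hT ⊢
    exact ⟨sdiff_subset, by rw [card_sdiff_of_subset hT.1]; omega⟩
  · intro T hT
    rw [mem_powersetCard] at hT ⊢
    exact ⟨sdiff_subset, by rw [card_sdiff_of_subset hT.1]; omega⟩
  · intro T hT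
    exact Finset.sdiff_sdiff_eq_self (mem_powersetCard.1 hT).1
  · intro T hT
    exact Finset.sdiff_sdiff_eq_self (mem_powersetCard.1 hT).1
  · intro T hT
    rw [Finset.sdiff_sdiff_eq_self (mem_powersetCard.1 hT).1]

/-! ### Martingale concentration for random subsets. -/

/-- Replacing one element of an `m`-element subset of `A` changes `φ` by at most `β`. -/
def SwapLipschitz (A : Finset Z) (m : ℕ) (β : ℝ) (φ : Finset Z → ℝ) : Prop :=
  ∀ C ⊆ A, C.card + 1 = m → ∀ a ∈ A \ C, ∀ b ∈ A \ C, φ (insert a C) - φ (insert b C) ≤ β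

lemma SwapLipschitz.neg {A : Finset Z} {m : ℕ} {β : ℝ} {φ : Finset Z → ℝ}
    (h : SwapLipschitz A m β φ) : SwapLipschitz A m β (fun S => -φ S) :=
  fun C hC hm a ha b hb => by linarith [h C hC hm b hb a ha]

lemma sum_powersetCard_succ_insert {x : Z} {B : Finset Z} (hx : x ∉ B) (m : ℕ)
    (g : Finset Z → ℝ) :
    ∑ S ∈ powersetCard (m + 1) (insert x B), g S
      = ∑ S ∈ powersetCard (m + 1) B, g S + ∑ S ∈ powersetCard m B, g (insert x S) := by
  have hmem : ∀ k, ∀ S ∈ powersetCard k B, x ∉ S := fun k S hS h =>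
    hx ((mem_powersetCard.1 hS).1 h)
  rw [powersetCard_succ_insert hx, sum_union, sum_image]
  · intro S hS T hT h
    rw [← erase_insert (hmem _ S hS), ← erase_insert (hmem _ T hT)]
    exact congrArg (fun U => U.erase x) h
  · rw [disjoint_left]
    intro S hS hS'
    obtain ⟨T, -, rfl⟩ := mem_image.1 hS'
    exact hmem _ _ hS (mem_insert_self _ _)

/-- Samples containing both `x` and `y` occur on both sides and cancel. The others pair up by a
swap, and their proportion is `u / (u + m)`. -/
lemma SwapLipschitz.expSubset_insert_sub_le {A : Finset Z} {m u : ℕ} {β : ℝ}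
    {φ : Finset Z → ℝ} (h : SwapLipschitz A (m + 1) β φ) (hu : 1 ≤ u) (hβ : 0 ≤ β)
    (hA : A.card = m + 1 + u) {x y : Z} (hx : x ∈ A) (hy : y ∈ A) :
    expSubset (A.erase x) m (fun T => φ (insert x T))
      - expSubset (A.erase y) m (fun T => φ (insert y T)) ≤ β * u / (u + m) := by
  have hu0 : (0 : ℝ) < u := by exact_mod_cast hu
  rcases eq_or_ne x y with rfl | hxy
  · rw [sub_self]; positivity
  set B := (A.erase x).erase y with hB
  have hBc : B.card = m + u - 1 := by
    rw [hB, card_erase_of_mem (mem_erase.2 ⟨hxy.symm, hy⟩), card_erase_of_mem hx]; omega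
  have hyB : y ∉ B := by simp [hB]
  have hxB : x ∉ B := by simp [hB]
  have hAx : A.erase x = insert y B := by rw [hB, insert_erase (mem_erase.2 ⟨hxy.symm, hy⟩)]
  have hAy : A.erase y = insert x B := by
    rw [hB, erase_right_comm, insert_erase (mem_erase.2 ⟨hxy, hx⟩)]
  have hBA : B ⊆ A := (erase_subset _ _).trans (erase_subset _ _)
  have hmain : ∑ T ∈ powersetCard m (A.erase x), φ (insert x T)
      - ∑ T ∈ powersetCard m (A.erase y), φ (insert y T) ≤ (m + u - 1).choose m * β := by
    have hle : ∑ T ∈ powersetCard m B, φ (insert x T) - ∑ T ∈ powersetCard m B, φ (insert y T)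
        ≤ (m + u - 1).choose m * β := by
      rw [← sum_sub_distrib]
      refine (sum_le_card_nsmul _ _ β fun T hT => ?_).trans_eq ?_
      · rw [mem_powersetCard] at hT
        exact h T (hT.1.trans hBA) (by rw [hT.2]) x
          (mem_sdiff.2 ⟨hx, fun hxT => hxB (hT.1 hxT)⟩) y
          (mem_sdiff.2 ⟨hy, fun hyT => hyB (hT.1 hyT)⟩)
      · rw [card_powersetCard, hBc, nsmul_eq_mul]
    rcases m with _ | k
    · simpa using hle
    · rw [hAx, hAy, sum_powersetCard_succ_insert hyB, sum_powersetCard_succ_insert hxB]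
      have : ∀ T, insert x (insert y T) = insert y (insert x T) := fun T => Finset.insert_comm _ _ _
      simp only [this]
      linarith
  have hcard : ∀ z ∈ A, ((powersetCard m (A.erase z)).card : ℝ) = (m + u).choose m :=
    fun z hz => by rw [card_powersetCard, card_erase_of_mem hz, hA]; congr 2; omega
  unfold expSubset
  rw [expect_eq_sum_div_card, expect_eq_sum_div_card, hcard x hx, hcard y hy, ← sub_div]
  have hC : (0 : ℝ) < (m + u).choose m := by
    exact_mod_cast Nat.choose_pos (Nat.le_add_right m u)
  have hratio : ((m + u - 1).choose m : ℝ) * (u + m) = (m + u).choose m * u := by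
    have := Nat.choose_mul_succ_eq (m + u - 1) m
    rw [show m + u - 1 + 1 = m + u by omega, show m + u - m = u by omega] at this
    exact_mod_cast (by rw [add_comm u m]; exact this)
  rw [div_le_div_iff₀ hC (by positivity)]
  refine (mul_le_mul_of_nonneg_right hmain (by positivity)).trans_eq ?_
  linear_combination β * hratio

/-- Reveal one element `x` and recurse on `A.erase x`: the number `u` of unsampled points is
unchanged, and the conditional means `a x` form the martingale increment handled by `expect_exp_le`.
-/
theorem SwapLipschitz.expSubset_exp_le {u : ℕ} (hu : 1 ≤ u) {β l : ℝ} (hβ : 0 < β) (hl : 0 < l)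
    (hlβ : l * β / 2 ≤ 2) {m : ℕ} {A : Finset Z} (hA : A.card = m + u) {φ : Finset Z → ℝ}
    (h : SwapLipschitz A m β φ) :
    expSubset A m (fun S => exp (l * (φ S - expSubset A m φ)))
      ≤ exp (∑ k ∈ range m, hoeffdingExponent (l * (β * u / (u + k)) / 2)) := by
  induction m generalizing A φ with
  | zero => simp [expSubset]
  | succ m ih =>
    have hu0 : (0 : ℝ) < u := by exact_mod_cast hu
    have hne : A.Nonempty := card_pos.1 (by omega)
    set a : Z → ℝ := fun x => expSubset (A.erase x) m (fun T => φ (insert x T)) with ha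
    have hmean : expSubset A (m + 1) φ = 𝔼 x ∈ A, a x := expSubset_succ A m φ
    have hx : ∀ x ∈ A, expSubset (A.erase x) m
        (fun T => exp (l * (φ (insert x T) - expSubset A (m + 1) φ)))
        ≤ exp (l * (a x - 𝔼 x ∈ A, a x))
          * exp (∑ k ∈ range m, hoeffdingExponent (l * (β * u / (u + k)) / 2)) := by
      intro x hx
      have hLip : SwapLipschitz (A.erase x) m β (fun T => φ (insert x T)) := by
        intro C hC hm c hc b hb
        rw [mem_sdiff, mem_erase] at hc hb
        have hxC : x ∉ C := fun hxC => by simpa using hC hxC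
        beta_reduce
        rw [Finset.insert_comm x c, Finset.insert_comm x b]
        refine h (insert x C) (insert_subset hx (hC.trans (erase_subset _ _))) ?_ c ?_ b ?_
        · rw [card_insert_of_notMem hxC, hm]
        · simp [hc.1.1, hc.1.2, hc.2]
        · simp [hb.1.1, hb.1.2, hb.2]
      refine le_of_eq_of_le ?_ (mul_le_mul_of_nonneg_left
        (ih (A := A.erase x) (by rw [card_erase_of_mem hx]; omega) hLip) (exp_pos _).le)
      rw [hmean]
      unfold expSubset
      rw [mul_expect]
      refine expect_congr rfl fun T _ => ?_
      rw [← exp_add]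
      congr 1
      simp only [ha, expSubset]
      ring
    rw [expSubset_succ]
    refine (expect_le_expect hx).trans ?_
    rw [← expect_mul, sum_range_succ, add_comm, exp_add]
    refine mul_le_mul_of_nonneg_right ?_ (exp_pos _).le
    have hden : β * u / (u + m) ≤ β := by
      rw [div_le_iff₀ (by positivity)]
      have : 0 ≤ β * m := by positivity
      linarith
    refine expect_exp_le hne (by positivity) hl ?_ ?_ fun x hx y hy => ?_
    · nlinarith
    · rw [expect_sub_distrib, expect_const hne, sub_self]
    · have := h.expSubset_insert_sub_le hu hβ.le hA hx hy
      simp only [ha]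
      linarith

/-- Concentration of a function of a random half of `A` around its mean. -/
theorem SwapLipschitz.probSubset_le {u : ℕ} (hu : 2 ≤ u) {A : Finset Z} (hA : A.card = u + u)
    {φ : Finset Z → ℝ} (h : SwapLipschitz A u (2 / u) φ) {ε : ℝ} (hε : 0 < ε) (hε1 : ε ≤ 1)
    {P : Finset Z → Prop} (hP : ∀ S ⊆ A, S.card = u → P S → expSubset A u φ + ε ≤ φ S) :
    probSubset A u P ≤ exp (-(ε ^ 2 * (2 * u - 1 / 2) ^ 2 / (2 * (2 * u)))) := by
  classical
  have hu2 : (2 : ℝ) ≤ u := by exact_mod_cast hu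
  have hu0 : (0 : ℝ) < u := by linarith
  set D : ℝ := (2 * u - 1 / 2) ^ 2 / (2 * u) with hD
  have hpos : 0 < (2 * (u : ℝ) - 1 / 2) := by linarith
  have hD0 : 0 < D := by positivity
  have hD2 : D ≤ 2 * u := by
    rw [hD, div_le_iff₀ (by positivity)]; nlinarith
  have hne : (powersetCard u A).Nonempty := powersetCard_nonempty.2 (by omega)
  -- The usual Chernoff parameter for variance proxy `1 / D`; `ε ≤ 1` keeps it in the range of the
  -- refined Hoeffding lemma.
  have hmgf := h.expSubset_exp_le (l := ε * D) (by omega) (by positivity) (by positivity)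
    (by
      rw [show ε * D * (2 / (u : ℝ)) / 2 = ε * (D / u) by ring]
      have h1 : D / u ≤ 2 := (div_le_iff₀ hu0).2 hD2
      have h2 : 0 ≤ D / u := by positivity
      nlinarith) hA
  have e : ∀ k : ℕ, ε * D * (2 / (u : ℝ) * u / (u + k)) / 2 = ε * D / (u + k) := fun k => by
    field_simp
  simp only [e] at hmgf
  have hmgf2 := hmgf.trans (exp_sum_hoeffdingExponent_le (y := ε ^ 2 * D / 2) hu (by positivity)
    (by rw [← hD]; ring))
  have := card_filter_le_of_expect_exp_le (ε := ε) (X := fun S => φ S - expSubset A u φ) hne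
    (mul_pos hε hD0) (y := ε ^ 2 * D / 2) (by positivity) (by ring)
    (by rw [expect_sub_distrib, expect_const hne]; exact sub_self _) P
    (fun S hS hPS => by
      rw [mem_powersetCard] at hS
      linarith [hP S hS.1 hS.2 hPS]) hmgf2
  rw [show ε ^ 2 * (2 * u - 1 / 2) ^ 2 / (2 * (2 * u)) = ε ^ 2 * D / 2 by rw [hD]; ring]
  unfold probSubset
  convert this

end

/-! ### The supremum of gaps, the permutational complexity and symmetrization. -/

section

variable {Z : Type*}

lemma iSup_le_iSup_add {ι : Sort*} {f g : ι → ℝ} {c : ℝ} (hc : 0 ≤ c)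
    (hg : BddAbove (Set.range g)) (h : ∀ i, f i ≤ g i + c) : ⨆ i, f i ≤ (⨆ i, g i) + c := by
  rcases isEmpty_or_nonempty ι with hι | hι
  · simpa using hc
  · exact ciSup_le fun i => (h i).trans (add_le_add_left (le_ciSup hg i) c)

lemma avg_mem_Icc {f : Z → ℝ} (hf : ∀ z, f z ∈ Set.Icc (0 : ℝ) 1) (S : Finset Z) :
    avg f S ∈ Set.Icc (0 : ℝ) 1 := by
  rcases S.eq_empty_or_nonempty with rfl | hS
  · simp [avg]
  · exact ⟨le_expect hS fun z _ => (hf z).1,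
      expect_le hS fun z _ => (hf z).2⟩

/-- The largest difference, over the class `F`, between the averages over `S` and over `T`. -/
def supGap (F : Set (Z → ℝ)) (S T : Finset Z) : ℝ := ⨆ f : F, (avg (f : Z → ℝ) S - avg f T)

lemma bddAbove_range_avg_sub {F : Set (Z → ℝ)}
    (hF : ∀ f ∈ F, ∀ z, f z ∈ Set.Icc (0 : ℝ) 1) (S T : Finset Z) :
    BddAbove (Set.range fun f : F => avg (f : Z → ℝ) S - avg f T) := by
  refine ⟨1, ?_⟩
  rintro _ ⟨f, rfl⟩
  have h1 := avg_mem_Icc (hF f f.2) S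
  have h2 := avg_mem_Icc (hF f f.2) T
  dsimp only
  linarith [h1.2, h2.1]

lemma avg_sub_avg_le_supGap {F : Set (Z → ℝ)}
    (hF : ∀ f ∈ F, ∀ z, f z ∈ Set.Icc (0 : ℝ) 1) {f : Z → ℝ} (hf : f ∈ F) (S T : Finset Z) :
    avg f S - avg f T ≤ supGap F S T :=
  le_ciSup (bddAbove_range_avg_sub hF S T) ⟨f, hf⟩

lemma avg_insert_sub_avg_insert_le [DecidableEq Z] {f : Z → ℝ} (hf : ∀ z, f z ∈ Set.Icc (0 : ℝ) 1)
    {C : Finset Z} {a b : Z} (ha : a ∉ C) (hb : b ∉ C) {k : ℕ} (hk : C.card + 1 = k) :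
    avg f (insert a C) - avg f (insert b C) ≤ 1 / k := by
  unfold avg
  rw [expect_eq_sum_div_card, expect_eq_sum_div_card, card_insert_of_notMem ha,
    card_insert_of_notMem hb, sum_insert ha, sum_insert hb, hk, ← sub_div]
  gcongr
  linarith [(hf a).2, (hf b).1]

lemma supGap_insert_left_le [DecidableEq Z] {F : Set (Z → ℝ)}
    (hF : ∀ f ∈ F, ∀ z, f z ∈ Set.Icc (0 : ℝ) 1) {C T : Finset Z} {a b : Z} (ha : a ∉ C) (hb : b ∉ C) {k : ℕ}
    (hk : C.card + 1 = k) : supGap F (insert a C) T ≤ supGap F (insert b C) T + 1 / k :=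
  iSup_le_iSup_add (by positivity) (bddAbove_range_avg_sub hF _ _) fun f => by
    linarith [avg_insert_sub_avg_insert_le (hF f f.2) ha hb hk]

lemma supGap_insert_right_le [DecidableEq Z] {F : Set (Z → ℝ)}
    (hF : ∀ f ∈ F, ∀ z, f z ∈ Set.Icc (0 : ℝ) 1) {C T : Finset Z} {a b : Z} (ha : a ∉ C) (hb : b ∉ C) {k : ℕ}
    (hk : C.card + 1 = k) : supGap F T (insert a C) ≤ supGap F T (insert b C) + 1 / k :=
  iSup_le_iSup_add (by positivity) (bddAbove_range_avg_sub hF _ _) fun f => by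
    linarith [avg_insert_sub_avg_insert_le (hF f f.2) hb ha hk]

lemma swapLipschitz_supGap [DecidableEq Z] {F : Set (Z → ℝ)}
    (hF : ∀ f ∈ F, ∀ z, f z ∈ Set.Icc (0 : ℝ) 1) {A : Finset Z} {m : ℕ} (hA : A.card = m + m) :
    SwapLipschitz A m (2 / m) (fun S => supGap F (A \ S) S) := by
  intro C hC hm a ha b hb
  rw [mem_sdiff] at ha hb
  rcases eq_or_ne a b with rfl | hab
  · rw [sub_self]; positivity
  set E := A \ insert a (insert b C) with hE
  have e1 : A \ insert a C = insert b E := by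
    ext z
    simp only [hE, mem_sdiff, mem_insert]
    by_cases hz : z = b
    · subst hz; simp [hb.1, hb.2, hab.symm]
    · simp [hz]
  have e2 : A \ insert b C = insert a E := by
    ext z
    simp only [hE, mem_sdiff, mem_insert]
    by_cases hz : z = a
    · subst hz; simp [ha.1, ha.2, hab]
    · simp [hz]
  have haE : a ∉ E := by simp [hE]
  have hbE : b ∉ E := by simp [hE]
  have hEc : E.card + 1 = m := by
    rw [hE, card_sdiff_of_subset (insert_subset ha.1 (insert_subset hb.1 hC)),
      card_insert_of_notMem (by simp [hab, ha.2]), card_insert_of_notMem hb.2]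
    omega
  dsimp only
  rw [e1, e2]
  have h1 := supGap_insert_left_le hF (T := insert a C) hbE haE hEc
  have h2 := supGap_insert_right_le hF (T := insert a E) ha.2 hb.2 hm
  have : (2 : ℝ) / m = 1 / m + 1 / m := by ring
  linarith

lemma prc_eq_expSubset [DecidableEq Z] (F : Set (Z → ℝ)) (n : ℕ) (S : Finset Z) :
    prc F n S = expSubset S n fun B => supGap F (S \ B) B := rfl

/-- The swapped element lies in `B` with probability `n / m`, at a cost of `1 / n`, and otherwise in
the complement, at a cost of `1 / (m - n)`. Each case contributes `1 / m`. -/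
lemma swapLipschitz_prc [DecidableEq Z] {F : Set (Z → ℝ)}
    (hF : ∀ f ∈ F, ∀ z, f z ∈ Set.Icc (0 : ℝ) 1) {A : Finset Z} {m n : ℕ} (hn : 1 ≤ n) (hnm : n < m) :
    SwapLipschitz A m (2 / m) (prc F n) := by
  intro C _ hm a ha b hb
  rw [mem_sdiff] at ha hb
  obtain ⟨k, rfl⟩ : ∃ k, n = k + 1 := ⟨n - 1, by omega⟩
  have hsplit : ∀ x ∉ C, prc F (k + 1) (insert x C) =
      (∑ B ∈ powersetCard (k + 1) C, supGap F (insert x (C \ B)) B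
        + ∑ B ∈ powersetCard k C, supGap F (C \ B) (insert x B)) / (m.choose (k + 1) : ℝ) := by
    intro x hx
    rw [prc_eq_expSubset, expSubset, expect_eq_sum_div_card, card_powersetCard,
      card_insert_of_notMem hx, hm, sum_powersetCard_succ_insert hx]
    congr 2
    · refine sum_congr rfl fun B hB => ?_
      rw [insert_sdiff_of_notMem _ fun h => hx ((mem_powersetCard.1 hB).1 h)]
    · refine sum_congr rfl fun B hB => ?_
      rw [insert_sdiff_insert, sdiff_insert_of_notMem hx]
  have hc : (0 : ℝ) < m.choose (k + 1) := by exact_mod_cast Nat.choose_pos hnm.le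
  rw [hsplit a ha.2, hsplit b hb.2, ← sub_div, div_le_iff₀ hc]
  have h1 : ∑ B ∈ powersetCard (k + 1) C, supGap F (insert a (C \ B)) B
      ≤ ∑ B ∈ powersetCard (k + 1) C, supGap F (insert b (C \ B)) B
        + (m - 1).choose (k + 1) * (1 / (m - (k + 1) : ℕ)) := by
    have : ((m - 1).choose (k + 1) : ℝ) * (1 / (m - (k + 1) : ℕ))
        = ∑ B ∈ powersetCard (k + 1) C, (1 / (m - (k + 1) : ℕ) : ℝ) := by
      rw [sum_const, card_powersetCard, nsmul_eq_mul, ← hm, Nat.add_sub_cancel]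
    rw [this, ← sum_add_distrib]
    refine sum_le_sum fun B hB => ?_
    rw [mem_powersetCard] at hB
    refine supGap_insert_left_le hF (fun h => ha.2 (mem_sdiff.1 h).1)
      (fun h => hb.2 (mem_sdiff.1 h).1) ?_
    rw [card_sdiff_of_subset hB.1]; omega
  have h2 : ∑ B ∈ powersetCard k C, supGap F (C \ B) (insert a B)
      ≤ ∑ B ∈ powersetCard k C, supGap F (C \ B) (insert b B)
        + (m - 1).choose k * (1 / (k + 1 : ℕ)) := by
    have : ((m - 1).choose k : ℝ) * (1 / (k + 1 : ℕ))
        = ∑ B ∈ powersetCard k C, (1 / (k + 1 : ℕ) : ℝ) := by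
      rw [sum_const, card_powersetCard, nsmul_eq_mul, ← hm, Nat.add_sub_cancel]
    rw [this, ← sum_add_distrib]
    refine sum_le_sum fun B hB => ?_
    rw [mem_powersetCard] at hB
    exact supGap_insert_right_le hF (fun h => ha.2 (hB.1 h)) (fun h => hb.2 (hB.1 h))
      (by rw [hB.2])
  have hm0 : (0 : ℝ) < m := by exact_mod_cast (by omega : 0 < m)
  have h3 : ((m - 1).choose (k + 1) : ℝ) * (1 / (m - (k + 1) : ℕ))
      = 1 / m * m.choose (k + 1) := by
    have h := Nat.choose_mul_succ_eq (m - 1) (k + 1)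
    rw [show m - 1 + 1 = m by omega] at h
    have h' : ((m - 1).choose (k + 1) : ℝ) * m = m.choose (k + 1) * (m - (k + 1) : ℕ) := by
      exact_mod_cast h
    have hmk : (0 : ℝ) < (m - (k + 1) : ℕ) := by exact_mod_cast (by omega : 0 < m - (k + 1))
    rw [mul_one_div, one_div_mul_eq_div, div_eq_div_iff hmk.ne' hm0.ne', h']
  have h4 : ((m - 1).choose k : ℝ) * (1 / (k + 1 : ℕ)) = 1 / m * m.choose (k + 1) := by
    have h := Nat.add_one_mul_choose_eq (m - 1) k
    rw [show m - 1 + 1 = m by omega] at h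
    have h' : (m : ℝ) * (m - 1).choose k = m.choose (k + 1) * (k + 1 : ℕ) := by exact_mod_cast h
    rw [mul_one_div, one_div_mul_eq_div,
      div_eq_div_iff (by positivity) hm0.ne', ← h', mul_comm]
  have : (2 : ℝ) / m * m.choose (k + 1)
      = 1 / m * m.choose (k + 1) + 1 / m * m.choose (k + 1) := by ring
  linarith

/-- For a single `f` the gap averages to zero over `B`, and the supremum dominates it. -/
lemma prc_nonneg [DecidableEq Z] {F : Set (Z → ℝ)}
    (hF : ∀ f ∈ F, ∀ z, f z ∈ Set.Icc (0 : ℝ) 1) {S : Finset Z} {n : ℕ} (hn : 1 ≤ n) (hnS : n < S.card) : 0 ≤ prc F n S := by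
  rcases F.eq_empty_or_nonempty with rfl | ⟨f, hf⟩
  · simp [prc, expSubset]
  have h : expSubset S n (fun B => avg f (S \ B)) = avg f S := by
    have h1 := expSubset_expSubset_sdiff_comm S n (S.card - n) fun B _ => avg f (S \ B)
    have h2 : ∀ B ⊆ S, B.card = n →
        (expSubset (S \ B) (S.card - n) fun T => avg f T) = avg f (S \ B) := fun B hB hBn => by
      rw [expSubset_avg (by omega) (by rw [card_sdiff_of_subset hB, hBn])]
    have h3 := expSubset_expSubset_sdiff_comm S n (S.card - n) fun _ T => avg f T
    rw [← expSubset_congr h2, h3]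
    rw [← expSubset_avg (A := S) (n := S.card - n) (by omega) (by omega) f]
    refine expSubset_congr fun T hT hTc => expSubset_const ?_ _
    rw [card_sdiff_of_subset hT]; omega
  have h0 : expSubset S n (fun B => avg f (S \ B) - avg f B) = 0 := by
    have := expSubset_avg hn hnS.le f
    unfold expSubset at *
    rw [expect_sub_distrib, h, this, sub_self]
  rw [← h0, prc_eq_expSubset]
  exact expSubset_mono fun B _ _ => avg_sub_avg_le_supGap hF hf _ _

/-- Symmetrization: the expected largest gap between the two halves of `A` is at most the
expected permutational Rademacher complexity. -/
theorem expSubset_supGap_le_expSubset_prc [DecidableEq Z] {F : Set (Z → ℝ)}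
    (hF : ∀ f ∈ F, ∀ z, f z ∈ Set.Icc (0 : ℝ) 1) {A : Finset Z} {m n : ℕ} (hA : A.card = m + m)
    (hn : 1 ≤ n) (hnm : n < m) :
    expSubset A m (fun S => supGap F (A \ S) S) ≤ expSubset A m (prc F n) := by
  -- Jensen: both averages are means over random subsets `T` and `B`, and the supremum of a mean is
  -- at most the mean of the suprema. The pair `(T, B)` is then a uniform disjoint pair, as in the
  -- definition of `prc`.
  have hJ : ∀ S ⊆ A, S.card = m → supGap F (A \ S) S
      ≤ expSubset S n fun B => expSubset (A \ S) (m - n) fun T => supGap F T B := by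
    intro S hS hSm
    have hAS : (A \ S).card = m := by rw [card_sdiff_of_subset hS]; omega
    rcases F.eq_empty_or_nonempty with rfl | hne
    · simp [supGap, expSubset]
    have := hne.to_subtype
    refine ciSup_le fun f => ?_
    rw [← expSubset_avg (A := S) hn (by omega) f,
      ← expSubset_avg (A := A \ S) (n := m - n) (by omega) (by omega) f]
    rw [← expSubset_const (A := S) (m := n) (by omega) (expSubset (A \ S) (m - n) (avg f))]
    unfold expSubset
    rw [← expect_sub_distrib]
    refine expect_le_expect fun B _ => ?_
    refine le_of_eq_of_le ?_ (expect_le_expect fun T _ => avg_sub_avg_le_supGap hF f.2 T B)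
    rw [expect_sub_distrib, expect_const (powersetCard_nonempty.2 (by omega))]
  refine (expSubset_mono hJ).trans_eq ?_
  have hS : ∀ S ⊆ A, S.card = m →
      (expSubset S n fun B => expSubset (A \ S) (m - n) fun T => supGap F T B)
        = expSubset S n fun B => expSubset ((A \ B) \ (S \ B)) (m - n)
          fun T => supGap F T B := fun S _ _ =>
    expSubset_congr fun B hB _ => by rw [sdiff_sdiff_left, sup_eq_union, union_sdiff_of_subset hB]
  rw [expSubset_congr hS, expSubset_expSubset_subset hnm.le fun X B =>
    expSubset ((A \ B) \ X) (m - n) fun T => supGap F T B]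
  refine Eq.trans ?_ (expSubset_expSubset_subset hnm.le (supGap F)).symm
  refine expSubset_congr fun B hB hBn => ?_
  rw [expSubset_expSubset_sdiff_comm]
  refine expSubset_congr fun T hT hTc => expSubset_const ?_ _
  rw [card_sdiff_of_subset hT, card_sdiff_of_subset hB]
  omega

end

/-! ### From concentration to the uniform bounds. -/

section

variable {Z : Type*}

lemma probSubset_le_add (A : Finset Z) (m : ℕ) {P Q R : Finset Z → Prop}
    (h : ∀ S ⊆ A, S.card = m → P S → Q S ∨ R S) :
    probSubset A m P ≤ probSubset A m Q + probSubset A m R := by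
  classical
  unfold probSubset
  rw [← add_div]
  gcongr
  norm_cast
  refine le_trans (card_le_card fun S hS => ?_) (card_union_le _ _)
  rw [mem_filter, mem_powersetCard] at hS
  rw [mem_union, mem_filter, mem_filter, mem_powersetCard]
  exact (h S hS.1.1 hS.1.2 hS.2).imp (⟨hS.1, ·⟩) (⟨hS.1, ·⟩)

lemma probSubset_eq_one {A : Finset Z} {m : ℕ} (hm : m ≤ A.card) {P : Finset Z → Prop}
    (h : ∀ S ⊆ A, S.card = m → P S) : probSubset A m P = 1 := by
  classical
  unfold probSubset
  rw [filter_true_of_mem fun S hS => h S (mem_powersetCard.1 hS).1 (mem_powersetCard.1 hS).2]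
  exact div_self (by exact_mod_cast (card_pos.2 (powersetCard_nonempty.2 hm)).ne')

/-- The deviation in the concentration inequality for random halves of an `N`-element set at
confidence level `1 - δ`. -/
def deviation (N : ℕ) (δ : ℝ) : ℝ :=
  √(2 * (N : ℝ) * log (1 / δ) / ((N : ℝ) - 1 / 2) ^ 2)

lemma SwapLipschitz.probSubset_deviation_le [DecidableEq Z] {u : ℕ} (hu : 2 ≤ u) {A : Finset Z}
    (hA : A.card = u + u) {φ : Finset Z → ℝ} (h : SwapLipschitz A u (2 / u) φ) {δ : ℝ}
    (hδ0 : 0 < δ) (hδ1 : δ < 1) (hdev : deviation (u + u) δ ≤ 1) :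
    probSubset A u (fun S => expSubset A u φ + deviation (u + u) δ ≤ φ S) ≤ δ := by
  have hlog : 0 < log (1 / δ) := log_pos ((one_lt_div hδ0).2 hδ1)
  have hu0 : (2 : ℝ) ≤ u := by exact_mod_cast hu
  have hpos : (0 : ℝ) < ((u + u : ℕ) : ℝ) - 1 / 2 := by push_cast; linarith
  have hN : (0 : ℝ) < ((u + u : ℕ) : ℝ) := by push_cast; linarith
  have hdev0 : 0 < deviation (u + u) δ := sqrt_pos.2 (by positivity)
  refine (h.probSubset_le hu hA hdev0 hdev fun S _ _ hS => hS).trans_eq ?_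
  have hsq : deviation (u + u) δ ^ 2
      = 2 * ((u + u : ℕ) : ℝ) * log (1 / δ) / (((u + u : ℕ) : ℝ) - 1 / 2) ^ 2 :=
    sq_sqrt (by positivity)
  have he : deviation (u + u) δ ^ 2 * (2 * u - 1 / 2) ^ 2 / (2 * (2 * u)) = log (1 / δ) := by
    rw [hsq, show (2 * (u : ℝ)) = ((u + u : ℕ) : ℝ) by push_cast; ring,
      div_mul_cancel₀ _ (by positivity), mul_div_assoc, mul_comm, div_mul_eq_mul_div,
      mul_div_assoc, div_self (by positivity), mul_one]
  rw [he, one_div, log_inv, neg_neg, exp_log hδ0]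

variable [DecidableEq Z]

/-- Uniform deviation bound with the expected permutational Rademacher complexity. -/
theorem le_probSubset_expSubset_prc {F : Set (Z → ℝ)}
    (hF : ∀ f ∈ F, ∀ z, f z ∈ Set.Icc (0 : ℝ) 1) {u n : ℕ} (hn : 1 ≤ n) (hnu : n < u)
    {A : Finset Z} (hA : A.card = u + u) {δ : ℝ} (hδ0 : 0 < δ) (hδ1 : δ < 1) :
    1 - δ ≤ probSubset A u (fun S => ∀ f ∈ F,
      avg f (A \ S) ≤ avg f S + expSubset A u (prc F n) + deviation (u + u) δ) := by
  have hE : 0 ≤ expSubset A u (prc F n) := by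
    rw [← expSubset_const (A := A) (m := u) (by omega) 0]
    exact expSubset_mono fun S _ hS => prc_nonneg hF hn (by omega)
  rcases le_or_gt (deviation (u + u) δ) 1 with hdev | hdev
  · have hsym := expSubset_supGap_le_expSubset_prc hF hA hn hnu
    have hconc := (swapLipschitz_supGap hF hA).probSubset_deviation_le (by omega) hA hδ0 hδ1 hdev
    rw [← probSubset_eq_one (A := A) (m := u) (P := fun _ => True) (by omega) (by simp)]
    refine sub_le_iff_le_add.2 ((probSubset_le_add A u fun S _ _ _ => ?_).trans
      (add_le_add_right hconc _))
    rw [or_iff_not_imp_right]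
    intro hS f hf
    linarith [avg_sub_avg_le_supGap hF hf (A \ S) S]
  · rw [probSubset_eq_one (by omega)]
    · linarith
    · intro S _ _ f hf
      linarith [(avg_mem_Icc (hF f hf) (A \ S)).2, (avg_mem_Icc (hF f hf) S).1]

/-- Uniform deviation bound with the empirical permutational Rademacher complexity. -/
theorem le_probSubset_prc {F : Set (Z → ℝ)}
    (hF : ∀ f ∈ F, ∀ z, f z ∈ Set.Icc (0 : ℝ) 1) {u n : ℕ} (hn : 1 ≤ n) (hnu : n < u)
    {A : Finset Z} (hA : A.card = u + u) {δ : ℝ} (hδ0 : 0 < δ) (hδ1 : δ < 1) :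
    1 - δ ≤ probSubset A u (fun S => ∀ f ∈ F,
      avg f (A \ S) ≤ avg f S + prc F n S + 2 * deviation (u + u) (δ / 2)) := by
  rcases le_or_gt (deviation (u + u) (δ / 2)) 1 with hdev | hdev
  · have hsym := expSubset_supGap_le_expSubset_prc hF hA hn hnu
    have hconc := (swapLipschitz_supGap hF hA).probSubset_deviation_le (by omega) hA
      (half_pos hδ0) (by linarith) hdev
    -- Only the lower tail of the complexity matters; each of the two bad events gets `δ / 2`.
    have hconc' := (swapLipschitz_prc (A := A) hF hn hnu).neg.probSubset_deviation_le (by omega) hA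
      (half_pos hδ0) (by linarith) hdev
    have hneg : expSubset A u (fun S => -prc F n S) = -expSubset A u (prc F n) := by
      unfold expSubset; rw [expect_neg_distrib]
    rw [hneg] at hconc'
    have h1 : (1 : ℝ) ≤ _ + (_ + _) :=
      (probSubset_eq_one (A := A) (m := u) (P := fun _ => True) (by omega) (by simp)).ge.trans
      ((probSubset_le_add A u (Q := fun S => ∀ f ∈ F,
        avg f (A \ S) ≤ avg f S + prc F n S + 2 * deviation (u + u) (δ / 2))
        (R := fun S => _ ∨ _) fun S _ _ _ => ?_).trans
        (add_le_add_right ((probSubset_le_add A u fun S _ _ h => h).trans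
          (add_le_add hconc hconc')) _))
    · linarith
    · rw [or_iff_not_imp_right, not_or]
      intro hS f hf
      linarith [avg_sub_avg_le_supGap hF hf (A \ S) S, hS.1, hS.2]
  · rw [probSubset_eq_one (by omega)]
    · linarith
    · intro S _ hS f hf
      linarith [(avg_mem_Icc (hF f hf) (A \ S)).2, (avg_mem_Icc (hF f hf) S).1,
        prc_nonneg (S := S) hF hn (by omega)]

end

end TransductivePRC

end

theorem theorem4 {X Y : Type*} [DecidableEq X] [DecidableEq Y]
    (loss : Y → Y → ℝ) (hloss : ∀ y y' : Y, 0 ≤ loss y y' ∧ loss y y' ≤ 1)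
    (H : Set (X → Y))
    (N m u n : ℕ) (hN : N = m + u) (hmu : m = u) (hn : 1 ≤ n) (hnm : n ≤ m - 1)
    (ZN : Finset (X × Y)) (hZN : ZN.card = N)
    (δ : ℝ) (hδ0 : 0 < δ) (hδ1 : δ < 1) :
    1 - δ ≤ TransductivePRC.probSubset ZN m (fun Zm => ∀ h ∈ H,
        TransductivePRC.risk loss h (ZN \ Zm) ≤ TransductivePRC.risk loss h Zm
          + TransductivePRC.expSubset ZN m
              (fun Sm => TransductivePRC.prc (TransductivePRC.lossClass loss H) n Sm)
          + Real.sqrt (2 * (N : ℝ) * Real.log (1 / δ) / ((N : ℝ) - 1 / 2) ^ 2))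
    ∧
    1 - δ ≤ TransductivePRC.probSubset ZN m (fun Zm => ∀ h ∈ H,
        TransductivePRC.risk loss h (ZN \ Zm) ≤ TransductivePRC.risk loss h Zm
          + TransductivePRC.prc (TransductivePRC.lossClass loss H) n Zm
          + 2 * Real.sqrt (2 * (N : ℝ) * Real.log (2 / δ) / ((N : ℝ) - 1 / 2) ^ 2)) := by
  subst hmu hN
  have hF : ∀ f ∈ TransductivePRC.lossClass loss H, ∀ z, f z ∈ Set.Icc (0 : ℝ) 1 := by
    rintro _ ⟨h, -, rfl⟩ z
    exact hloss _ _
  have hforall : ∀ Q : (X × Y → ℝ) → Prop, (∀ f ∈ TransductivePRC.lossClass loss H, Q f)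
      ↔ ∀ h ∈ H, Q (TransductivePRC.lossFun loss h) := fun Q =>
    ⟨fun hQ h hh => hQ _ ⟨h, hh, rfl⟩, by rintro hQ _ ⟨h, hh, rfl⟩; exact hQ h hh⟩
  have h1 := TransductivePRC.le_probSubset_expSubset_prc hF hn (by omega) hZN hδ0 hδ1
  have h2 := TransductivePRC.le_probSubset_prc hF hn (by omega) hZN hδ0 hδ1
  simp only [hforall] at h1 h2
  refine ⟨h1, ?_⟩
  rw [TransductivePRC.deviation, one_div_div] at h2
  exact h2
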